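/- For $n\ge 1$ let $L_n$ be the unoriented linear graph on $[n]=\{1,\dots,n\}$ with edges $1\leftrightarrow 2\leftrightarrow\cdots\leftrightarrow n$, each unoriented edge being identified with the two oriented edges $i\to i+1$ and $i+1\to i$, and let $E_0$ be the set of these oriented edges. Let $E_{\mathrm{open}}\subset ([n]\times[n])\setminus E_0$ be random: independently of each other, each rightward edge $i\to j$ with $j>i+1$ belongs to $E_{\mathrm{open}}$ with probability $p_{\mathrm{right}}=p_{\mathrm{right}}(n)\in[0,1]$, and each leftward edge $i\to j$ with $j<i-1$ with probability $p_{\mathrm{left}}=p_{\mathrm{left}}(n)\in[0,1]$; self-loops are never in $E_{\mathrm{open}}$. For $t\ge 0$ put $$E_{t+1}=E_t\cup\{\,i\to j\in E_{\mathrm{open}} : i\to k\in E_t \text{ and } k\to j\in E_t \text{ for some } k\in[n]\,\},\qquad E_\infty=\bigcup_{t\ge 0}E_t .$$ The length of an edge $i\to j$ is the number of edges on a shortest path from $i$ to $j$ in $L_n$, that is, $|i-j|$. Theorem. For every $c_1>0$ there is a $c_2>0$, depending only on $c_1$, such that the following holds. If $p_{\mathrm{left}}(n)<n^{-c_1}$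 and $p_{\mathrm{right}}(n)<c_2$ for all sufficiently large $n$, then asymptotically almost surely (i.e. with probability tending to $1$ as $n\to\infty$) $E_\infty$ contains no edge longer than $\log n$. -/

import Mathlib

open Filter Topology MeasureTheory ProbabilityTheory

namespace TransitiveClosure

/-- One step of the dynamics: an open edge `i → j` becomes occupied if there are occupied
edges `i → k` and `k → j` for some vertex `k`. -/
def step {V : Type*} (Eopen E : Set (V × V)) : Set (V × V) :=
  E ∪ {e | e ∈ Eopen ∧ ∃ k : V, (e.1, k) ∈ E ∧ (k, e.2) ∈ E}

/-- The set `E_t` of edges occupied at time `t`. -/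
def occupied {V : Type*} (E₀ Eopen : Set (V × V)) : ℕ → Set (V × V)
  | 0 => E₀
  | t + 1 => step Eopen (occupied E₀ Eopen t)

/-- The set `E_∞` of eventually occupied edges. -/
def eventuallyOccupied {V : Type*} (E₀ Eopen : Set (V × V)) : Set (V × V) :=
  ⋃ t : ℕ, occupied E₀ Eopen t

/-- The oriented edges of an unoriented graph: each edge counts in both directions. -/
def orientedEdges {V : Type*} (G : SimpleGraph V) : Set (V × V) :=
  {e | G.Adj e.1 e.2}

/-- The open edges of a configuration `ω`, when `E₀` is initially occupied: all initially
occupied edges and all self-loops are excluded. -/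
def openEdges {V : Type*} (E₀ : Set (V × V)) (ω : V × V → Bool) : Set (V × V) :=
  {e | e ∉ E₀ ∧ e.1 ≠ e.2 ∧ ω e = true}

/-- The density of rightward edges `i → j`, `i < j`, is `pRight`; that of leftward edges
`i → j`, `j < i`, is `pLeft` (the value at self-loops is irrelevant: they are never open). -/
noncomputable def edgeDensity {n : ℕ} (pLeft pRight : unitInterval) (e : Fin n × Fin n) :
    unitInterval :=
  if e.1 < e.2 then pRight else pLeft

/-- The law of the random configuration on `n` vertices: the coordinates are independent, and
the coordinate of `e` is `true` with probability `edgeDensity pLeft pRight e`. -/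
noncomputable def configMeasure (n : ℕ) (pLeft pRight : unitInterval) :
    Measure (Fin n × Fin n → Bool) :=
  Measure.pi fun e => bernoulliMeasure true false (edgeDensity pLeft pRight e)

/-- The set `E_∞` for the process started from the unoriented linear graph on `n` vertices. -/
def linearFinal (n : ℕ) (ω : Fin n × Fin n → Bool) : Set (Fin n × Fin n) :=
  eventuallyOccupied (orientedEdges (SimpleGraph.pathGraph n))
    (openEdges (orientedEdges (SimpleGraph.pathGraph n)) ω)

/-- The length of an edge `i → j`: the number of edges on a shortest path from `i` to `j` in the
linear graph. -/
noncomputable def edgeLength {n : ℕ} (e : Fin n × Fin n) : ℕ :=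
  (SimpleGraph.pathGraph n).dist e.1 e.2

end TransitiveClosure

/-! Leftward edges are so rare that, for a fixed `m` with `c₁ * (m + 1) ≥ 2`, a.a.s. no bounded
window contains `m + 1` open ones. An occupied leftward edge of length above `2 ^ m` would force
such a cluster: one of the two edges producing it goes left at least half as far, and halving
repeats (`exists_open_left`). So all occupied leftward edges have length at most `M = 2 ^ m`
(`left_short_of_no_cluster`).

A long edge is then rightward. Unfolding its derivation, without expanding any rightward edge twice,
gives a binary tree whose `N` nodes are distinct open rightward edges. Each interior vertex of the
edge is the apex of some node, so the length is at most `N + 1`. Since leaves go back by at most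
`M`, the tree has a word of length linear in `N` (`exists_splitTree`). At most `4 ^ ((2 * M + 3) *
(N + 1))` words compete with probability `pRight ^ N`, so for small `pRight` a union bound over `N >
log n - 1` concludes. -/

namespace TransitiveClosure

/-! ### Derivation trees and their encoding -/

/-- Binary trees whose leaves carry an integer displacement, written in unary. -/
inductive SplitTree
  | nil : SplitTree
  | right : SplitTree → SplitTree
  | left : SplitTree → SplitTree
  | node : SplitTree → SplitTree → SplitTree

namespace SplitTree

/-- The total displacement of the leaves. -/
def disp : SplitTree → ℤ
  | nil => 0
  | right t => 1 + t.disp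
  | left t => -1 + t.disp
  | node l r => l.disp + r.disp

/-- The edges of the polygon triangulation described by a tree, when its walk starts at `a`:
each node gives the edge from the start to the end of the walk of its subtree. -/
def edges (a : ℤ) : SplitTree → Finset (ℤ × ℤ)
  | nil => ∅
  | right t => t.edges (a + 1)
  | left t => t.edges (a - 1)
  | node l r => insert (a, a + (l.disp + r.disp)) (l.edges a ∪ r.edges (a + l.disp))

/-- The word of a tree in Polish notation. -/
def toWord : SplitTree → List (Fin 4)
  | nil => [0]
  | right t => 1 :: t.toWord
  | left t => 2 :: t.toWord
  | node l r => 3 :: (l.toWord ++ r.toWord)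

/-- Polish notation is prefix-free, so a tree can be read off the front of any longer word. -/
theorem toWord_append_inj (t : SplitTree) : ∀ (t' : SplitTree) (s s' : List (Fin 4)),
    t.toWord ++ s = t'.toWord ++ s' → t = t' ∧ s = s' := by
  induction t with
  | nil => intro t' s s' h; cases t' <;> simp_all [toWord]
  | right t ih =>
    intro t' s s' h
    cases t' <;> simp [toWord] at h
    obtain ⟨rfl, rfl⟩ := ih _ _ _ h
    exact ⟨rfl, rfl⟩
  | left t ih =>
    intro t' s s' h
    cases t' <;> simp [toWord] at h
    obtain ⟨rfl, rfl⟩ := ih _ _ _ h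
    exact ⟨rfl, rfl⟩
  | node l r ihl ihr =>
    intro t' s s' h
    cases t' <;> simp [toWord] at h
    obtain ⟨rfl, h2⟩ := ihl _ _ _ h
    obtain ⟨rfl, rfl⟩ := ihr _ _ _ h2
    exact ⟨rfl, rfl⟩

/-- The word of a tree, padded or cut to length `K`. -/
def code (K : ℕ) (t : SplitTree) : Fin K → Fin 4 := fun i => t.toWord.getD i 0

theorem code_inj {K : ℕ} {t t' : SplitTree} (ht : t.toWord.length ≤ K)
    (ht' : t'.toWord.length ≤ K) (h : t.code K = t'.code K) : t = t' := by
  refine (toWord_append_inj t t' (List.replicate (K - t.toWord.length) 0)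
    (List.replicate (K - t'.toWord.length) 0) ?_).1
  apply List.ext_getElem
  · simp; omega
  · intro i h1 h2
    have hi : i < K := by simp at h1; omega
    have := congrFun h ⟨i, hi⟩
    simp only [code, List.getD_eq_getElem?_getD] at this
    simp only [List.getElem_append, List.getElem_replicate]
    split_ifs with h3 h4 h4 <;> simp_all

theorem exists_leaf (d : ℤ) : ∃ t : SplitTree, t.disp = d ∧ (∀ a, t.edges a = ∅) ∧
    t.toWord.length = d.natAbs + 1 := by
  induction d using Int.induction_on with
  | zero => exact ⟨nil, rfl, fun _ => rfl, rfl⟩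
  | succ i ih =>
    obtain ⟨t, h1, h2, h3⟩ := ih
    refine ⟨right t, by simp [disp, h1]; ring, fun a => by simp [edges, h2], ?_⟩
    simp [toWord, h3]; omega
  | pred i ih =>
    obtain ⟨t, h1, h2, h3⟩ := ih
    refine ⟨left t, by simp [disp, h1]; ring, fun a => by simp [edges, h2], ?_⟩
    simp [toWord, h3]; omega

end SplitTree

/-! ### Derivations of occupied edges -/

theorem occupied_subset_succ {V : Type*} (E₀ Eopen : Set (V × V)) (t : ℕ) :
    occupied E₀ Eopen t ⊆ occupied E₀ Eopen (t + 1) :=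
  Set.subset_union_left

theorem mem_occupied_succ {V : Type*} {E₀ Eopen : Set (V × V)} {t : ℕ} {e : V × V}
    (h : e ∈ occupied E₀ Eopen (t + 1)) (h' : e ∉ occupied E₀ Eopen t) :
    e ∈ Eopen ∧ ∃ k, (e.1, k) ∈ occupied E₀ Eopen t ∧ (k, e.2) ∈ occupied E₀ Eopen t :=
  h.resolve_left h'

/-- The image of an edge on `Fin n` in `ℤ × ℤ`. -/
def intEdge {n : ℕ} (e : Fin n × Fin n) : ℤ × ℤ := ((e.1 : ℕ), (e.2 : ℕ))

theorem intEdge_injective {n : ℕ} : Function.Injective (intEdge (n := n)) := by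
  rintro ⟨a, b⟩ ⟨c, d⟩ h
  simp [intEdge] at h
  ext <;> simp [h]

/-- The interior vertices of all edges in `S` can be listed by `S` itself. -/
def InteriorBounded {n : ℕ} (S : Finset (Fin n × Fin n)) : Prop :=
  ∃ K : Finset ℤ, K.card ≤ S.card ∧
    ∀ e ∈ S, ∀ v : ℤ, ((e.1 : ℕ) : ℤ) < v → v < ((e.2 : ℕ) : ℤ) → v ∈ K

/-- `S` holds the edges already expanded elsewhere and `A` the newly expanded ones. With `N =
A.card` there are `N` nodes and `N + 1` leaves. A leaf of displacement `d ≥ -M` has word length `|d|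
+ 1 ≤ d + 2 * M + 1`; summing over leaves and adding one letter per node gives the length bound. -/
theorem exists_splitTree {n M : ℕ} {Eopen : Set (Fin n × Fin n)}
    (hM : ∀ t, ∀ e ∈ occupied (orientedEdges (SimpleGraph.pathGraph n)) Eopen t,
      (e.1 : ℕ) ≤ (e.2 : ℕ) + M) (t : ℕ) :
    ∀ e ∈ occupied (orientedEdges (SimpleGraph.pathGraph n)) Eopen t,
    ∀ S : Finset (Fin n × Fin n), InteriorBounded S →
    ∃ (T : SplitTree) (A : Finset (Fin n × Fin n)),
      Disjoint S A ∧
      (∀ f ∈ A, f ∈ occupied (orientedEdges (SimpleGraph.pathGraph n)) Eopen t) ∧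
      (∀ f ∈ A, f.1 < f.2 ∧ f ∈ Eopen) ∧
      A.image intEdge = T.edges (e.1 : ℕ) ∧
      ((e.2 : ℕ) : ℤ) = (e.1 : ℕ) + T.disp ∧
      (T.toWord.length : ℤ) ≤ T.disp + (2 * M + 1) + (2 * M + 2) * A.card ∧
      InteriorBounded (S ∪ A) ∧ (e ∈ S ∪ A ∨ (e.2 : ℕ) ≤ (e.1 : ℕ) + 1) := by
  -- Leftward and unit edges, and edges already in `S`, are not expanded: each becomes a unary leaf.
  have leafCase : ∀ (t : ℕ),
      ∀ e ∈ occupied (orientedEdges (SimpleGraph.pathGraph n)) Eopen t,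
      ∀ S : Finset (Fin n × Fin n), InteriorBounded S →
      (e ∈ S ∨ (e.2 : ℕ) ≤ (e.1 : ℕ) + 1) →
      ∃ (T : SplitTree) (A : Finset (Fin n × Fin n)),
      Disjoint S A ∧
      (∀ f ∈ A, f ∈ occupied (orientedEdges (SimpleGraph.pathGraph n)) Eopen t) ∧
      (∀ f ∈ A, f.1 < f.2 ∧ f ∈ Eopen) ∧
      A.image intEdge = T.edges (e.1 : ℕ) ∧
      ((e.2 : ℕ) : ℤ) = (e.1 : ℕ) + T.disp ∧
      (T.toWord.length : ℤ) ≤ T.disp + (2 * M + 1) + (2 * M + 2) * A.card ∧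
      InteriorBounded (S ∪ A) ∧ (e ∈ S ∪ A ∨ (e.2 : ℕ) ≤ (e.1 : ℕ) + 1) := by
    intro t e he S hS h
    obtain ⟨T, h1, h2, h3⟩ := SplitTree.exists_leaf (((e.2 : ℕ) : ℤ) - (e.1 : ℕ))
    have := hM t e he
    refine ⟨T, ∅, by simp, by simp, by simp, by simp [h2], by omega, ?_, by simpa, by simpa⟩
    rw [h1, h3, Finset.card_empty, Nat.cast_zero, mul_zero]; omega
  induction t with
  | zero =>
    intro e he S hS
    refine leafCase 0 e he S hS (Or.inr ?_)
    have : (SimpleGraph.pathGraph n).Adj e.1 e.2 := he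
    rw [SimpleGraph.pathGraph_adj] at this
    omega
  | succ t ih =>
    intro e he S hS
    by_cases het : e ∈ occupied (orientedEdges (SimpleGraph.pathGraph n)) Eopen t
    · obtain ⟨T, A, h1, h2, h⟩ := ih e het S hS
      exact ⟨T, A, h1, fun f hf => occupied_subset_succ _ _ _ (h2 f hf), h⟩
    by_cases hle : e ∈ S ∨ (e.2 : ℕ) ≤ (e.1 : ℕ) + 1
    · exact leafCase _ e he S hS hle
    push Not at hle
    obtain ⟨heS, hlt⟩ := hle
    obtain ⟨hop, k, hk1, hk2⟩ := mem_occupied_succ he het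
    obtain ⟨T₁, A₁, d1, o1, r1, i1, e1, l1, b1, m1⟩ := ih _ hk1 S hS
    -- The right subtree treats everything expanded on the left as known, so that `A₁` and `A₂` are
    -- disjoint.
    obtain ⟨T₂, A₂, d2, o2, r2, i2, e2, l2, b2, m2⟩ := ih _ hk2 (S ∪ A₁) b1
    simp only at e1 e2 i1 i2 m1 m2
    -- Edges in the subtrees are occupied by time `t`, whereas `e` is not.
    have n1 : e ∉ A₁ := fun h => het (o1 e h)
    have n2 : e ∉ A₂ := fun h => het (o2 e h)
    rw [Finset.disjoint_union_left] at d2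
    have hc : (insert e (A₁ ∪ A₂)).card = A₁.card + A₂.card + 1 := by
      rw [Finset.card_insert_of_notMem (by simp [n1, n2]), Finset.card_union_of_disjoint d2.2]
    have hdS : Disjoint S (insert e (A₁ ∪ A₂)) := by
      rw [Finset.disjoint_insert_right, Finset.disjoint_union_right]
      exact ⟨heS, d1, d2.1⟩
    refine ⟨.node T₁ T₂, insert e (A₁ ∪ A₂), hdS, ?_, ?_, ?_, ?_, ?_, ?_, ?_⟩
    · intro f hf
      rw [Finset.mem_insert, Finset.mem_union] at hf
      rcases hf with rfl | hf | hf
      · exact he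
      · exact occupied_subset_succ _ _ _ (o1 f hf)
      · exact occupied_subset_succ _ _ _ (o2 f hf)
    · intro f hf
      rw [Finset.mem_insert, Finset.mem_union] at hf
      rcases hf with rfl | hf | hf
      · exact ⟨by rw [Fin.lt_def]; omega, hop⟩
      · exact r1 f hf
      · exact r2 f hf
    · rw [Finset.image_insert, Finset.image_union, i1, i2, SplitTree.edges, ← e1]
      congr 1
      simp only [intEdge, Prod.mk.injEq, true_and]
      omega
    · simp only [SplitTree.disp]; omega
    · rw [hc]
      simp only [SplitTree.disp, SplitTree.toWord, List.length_cons, List.length_append]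
      push_cast
      linarith
    · obtain ⟨K, hK, hK'⟩ := b2
      -- The new edge costs one new vertex, its apex `k`: any other interior vertex of `e` is
      -- interior to `(e.1, k)` or `(k, e.2)`, even if `k` lies outside the span of `e`.
      refine ⟨insert ((k : ℕ) : ℤ) K, ?_, ?_⟩
      · refine (Finset.card_insert_le _ _).trans ?_
        rw [Finset.card_union_of_disjoint hdS, hc]
        have := Finset.card_union_le (S ∪ A₁) A₂
        have := Finset.card_union_le S A₁
        omega
      · intro f hf v hv1 hv2
        by_cases hfe : f = e
        · subst hfe
          rw [Finset.mem_insert]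
          rcases lt_trichotomy v ((k : ℕ) : ℤ) with h | h | h
          · right
            rcases m1 with m1 | m1
            · exact hK' _ (Finset.mem_union_left _ m1) v hv1 h
            · omega
          · exact Or.inl h
          · right
            rcases m2 with m2 | m2
            · exact hK' _ m2 v h hv2
            · omega
        · refine Finset.mem_insert_of_mem (hK' f ?_ v hv1 hv2)
          simp only [Finset.mem_union, Finset.mem_insert, hfe, false_or] at hf ⊢
          tauto
    · left; simp

/-- A long occupied rightward edge has a derivation with many distinct open rightward edges
and a short code. -/
theorem exists_splitTree_of_long {n M : ℕ} {Eopen : Set (Fin n × Fin n)}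
    (hM : ∀ t, ∀ e ∈ occupied (orientedEdges (SimpleGraph.pathGraph n)) Eopen t,
      (e.1 : ℕ) ≤ (e.2 : ℕ) + M) {t : ℕ} {e : Fin n × Fin n}
    (he : e ∈ occupied (orientedEdges (SimpleGraph.pathGraph n)) Eopen t)
    (hlong : (e.1 : ℕ) + 1 < (e.2 : ℕ)) :
    ∃ (T : SplitTree) (A : Finset (Fin n × Fin n)),
      (∀ f ∈ A, f.1 < f.2 ∧ f ∈ Eopen) ∧ A.image intEdge = T.edges (e.1 : ℕ) ∧
      T.toWord.length ≤ (2 * M + 3) * (A.card + 1) ∧ (e.2 : ℕ) ≤ e.1 + 1 + A.card := by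
  obtain ⟨T, A, -, -, hr, hi, hd, hl, ⟨K, hK, hK'⟩, hm⟩ :=
    exists_splitTree hM t e he ∅ ⟨∅, by simp, by simp⟩
  rw [Finset.empty_union] at hK hK' hm
  have heA : e ∈ A := hm.resolve_right (by omega)
  have hsub : Finset.Ioo ((e.1 : ℕ) : ℤ) ((e.2 : ℕ) : ℤ) ⊆ K := fun v hv =>
    hK' e heA v (Finset.mem_Ioo.1 hv).1 (Finset.mem_Ioo.1 hv).2
  have hcard := (Finset.card_le_card hsub).trans hK
  rw [Int.card_Ioo] at hcard
  refine ⟨T, A, hr, hi, ?_, by omega⟩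
  zify
  have : T.disp ≤ 1 + A.card := by omega
  linarith

/-! ### Leftward edges stay short -/

/-- A long occupied leftward edge forces many open leftward edges near its tail. -/
theorem exists_open_left {n D : ℕ} {Eopen : Set (Fin n × Fin n)} (t : ℕ) :
    (∀ e ∈ occupied (orientedEdges (SimpleGraph.pathGraph n)) Eopen t,
      (e.1 : ℕ) ≤ (e.2 : ℕ) + D) →
    ∀ (q : ℕ), ∀ e ∈ occupied (orientedEdges (SimpleGraph.pathGraph n)) Eopen t,
      (e.2 : ℕ) + 2 ^ q < (e.1 : ℕ) →
    ∃ A : Finset (Fin n × Fin n), A.card = q + 1 ∧ ∀ f ∈ A, f ∈ Eopen ∧ f.2 < f.1 ∧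
      f ∈ occupied (orientedEdges (SimpleGraph.pathGraph n)) Eopen t ∧
      (f.1 : ℕ) ≤ e.1 + q * D ∧ (e.1 : ℕ) ≤ f.1 + q * D := by
  induction t with
  | zero =>
    intro hD q e he hq
    have h : (SimpleGraph.pathGraph n).Adj e.1 e.2 := he
    rw [SimpleGraph.pathGraph_adj] at h
    have := Nat.one_le_two_pow (n := q)
    omega
  | succ t ih =>
    intro hD q e he hq
    have hD' := fun e he => hD e (occupied_subset_succ _ _ _ he)
    by_cases het : e ∈ occupied (orientedEdges (SimpleGraph.pathGraph n)) Eopen t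
    · obtain ⟨A, hA, h⟩ := ih hD' q e het hq
      refine ⟨A, hA, fun f hf => ?_⟩
      obtain ⟨h1, h2, h3, h4⟩ := h f hf
      exact ⟨h1, h2, occupied_subset_succ _ _ _ h3, h4⟩
    obtain ⟨hop, k, hk1, hk2⟩ := mem_occupied_succ he het
    have hlt : e.2 < e.1 := by rw [Fin.lt_def]; have := Nat.one_le_two_pow (n := q); omega
    cases q with
    | zero =>
      refine ⟨{e}, rfl, fun f hf => ?_⟩
      obtain rfl := Finset.mem_singleton.1 hf
      exact ⟨hop, hlt, he, by omega, by omega⟩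
    | succ q =>
      -- One of the two halves goes left by more than `2 ^ q`. Its tail is `e.1` or `k`, and `k` is
      -- within `D` of `e.1` because neither half goes left by more than `D`.
      have key : ∃ e' ∈ occupied (orientedEdges (SimpleGraph.pathGraph n)) Eopen t,
          (e'.2 : ℕ) + 2 ^ q < (e'.1 : ℕ) ∧ (e'.1 : ℕ) ≤ e.1 + D ∧ (e.1 : ℕ) ≤ e'.1 + D := by
        have hb1 := hD' _ hk1
        have hb2 := hD' _ hk2
        simp only at hb1 hb2
        rw [pow_succ] at hq
        by_cases hh : (k : ℕ) + 2 ^ q < (e.1 : ℕ)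
        · exact ⟨_, hk1, hh, by simp, by simp⟩
        · refine ⟨_, hk2, ?_, ?_, ?_⟩ <;> simp only <;> omega
      obtain ⟨e', he', hq', hc1, hc2⟩ := key
      obtain ⟨A, hA, h⟩ := ih hD' q e' he' hq'
      have heA : e ∉ A := fun hc => het (h e hc).2.2.1
      refine ⟨insert e A, by rw [Finset.card_insert_of_notMem heA, hA], fun f hf => ?_⟩
      rcases Finset.mem_insert.1 hf with rfl | hf
      · exact ⟨hop, hlt, he, by omega, by omega⟩
      · obtain ⟨h1, h2, h3, h4, h5⟩ := h f hf
        rw [add_mul, one_mul]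
        exact ⟨h1, h2, occupied_subset_succ _ _ _ h3, by omega, by omega⟩

/-- If no vertex has many open leftward edges nearby, then all occupied leftward edges are short. -/
theorem left_short_of_no_cluster {n m R : ℕ} {Eopen : Set (Fin n × Fin n)}
    (hR : (m + 1) * (2 * 2 ^ m) ≤ R)
    (h : ∀ (u : Fin n) (A : Finset (Fin n × Fin n)), A.card = m + 1 →
      ¬ ∀ f ∈ A, f ∈ Eopen ∧ f.2 < f.1 ∧ (f.1 : ℕ) ≤ u + R ∧ (u : ℕ) ≤ f.1 + R ∧
        (f.2 : ℕ) ≤ u + R ∧ (u : ℕ) ≤ f.2 + R) (t : ℕ) :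
    ∀ e ∈ occupied (orientedEdges (SimpleGraph.pathGraph n)) Eopen t,
      (e.1 : ℕ) ≤ (e.2 : ℕ) + 2 ^ m := by
  induction t with
  | zero =>
    intro e he
    have h : (SimpleGraph.pathGraph n).Adj e.1 e.2 := he
    rw [SimpleGraph.pathGraph_adj] at h
    have := Nat.one_le_two_pow (n := m)
    omega
  | succ t ih =>
    -- Lengths at most double in one step; this a priori bound keeps the whole cluster within `R`.
    have hD : ∀ e ∈ occupied (orientedEdges (SimpleGraph.pathGraph n)) Eopen (t + 1),
        (e.1 : ℕ) ≤ (e.2 : ℕ) + 2 * 2 ^ m := by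
      intro e he
      by_cases het : e ∈ occupied (orientedEdges (SimpleGraph.pathGraph n)) Eopen t
      · have := ih e het; omega
      · obtain ⟨-, k, hk1, hk2⟩ := mem_occupied_succ he het
        have h1 := ih _ hk1
        have h2 := ih _ hk2
        simp only at h1 h2
        omega
    intro e he
    by_contra! hlt
    obtain ⟨A, hA, hA'⟩ := exists_open_left (t + 1) hD m e he hlt
    refine h e.1 A hA fun f hf => ?_
    obtain ⟨h1, h2, h3, h4, h5⟩ := hA' f hf
    have := hD f h3
    have h2' : (f.2 : ℕ) < f.1 := h2
    rw [add_mul, one_mul] at hR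
    exact ⟨h1, h2, by omega, by omega, by omega, by omega⟩

theorem edgeLength_le {n : ℕ} (e : Fin n × Fin n) :
    edgeLength e ≤ ((e.2 : ℕ) - (e.1 : ℕ)) + ((e.1 : ℕ) - (e.2 : ℕ)) := by
  have key : ∀ (d : ℕ) (i j : Fin n), (i : ℕ) + d = j →
      ∃ w : (SimpleGraph.pathGraph n).Walk i j, w.length = d := by
    intro d
    induction d with
    | zero =>
      intro i j h
      obtain rfl : i = j := Fin.ext (by omega)
      exact ⟨.nil, rfl⟩
    | succ d ih =>
      intro i j h
      obtain ⟨w, hw⟩ := ih ⟨i + 1, by omega⟩ j (by simp; omega)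
      exact ⟨.cons (SimpleGraph.pathGraph_adj.2 (Or.inl rfl)) w, by simp [hw]⟩
  unfold edgeLength
  rcases le_total (e.1 : ℕ) (e.2 : ℕ) with h | h
  · obtain ⟨w, hw⟩ := key (e.2 - e.1) e.1 e.2 (by omega)
    have := SimpleGraph.dist_le w
    omega
  · obtain ⟨w, hw⟩ := key (e.1 - e.2) e.2 e.1 (by omega)
    have := SimpleGraph.dist_le w.reverse
    rw [SimpleGraph.Walk.length_reverse] at this
    omega


/-! ### Union bounds -/

instance (n : ℕ) (pLeft pRight : unitInterval) :
    IsProbabilityMeasure (configMeasure n pLeft pRight) := by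
  unfold configMeasure; infer_instance

theorem configMeasure_real_forall_open (n : ℕ) (pLeft pRight : unitInterval)
    (A : Finset (Fin n × Fin n)) :
    (configMeasure n pLeft pRight).real {ω | ∀ e ∈ A, ω e = true} =
      ∏ e ∈ A, (edgeDensity pLeft pRight e : ℝ) := by
  have h : {ω : Fin n × Fin n → Bool | ∀ e ∈ A, ω e = true} =
      (A : Set (Fin n × Fin n)).pi fun _ => {true} := by
    ext ω; simp [Set.mem_pi]
  rw [h, configMeasure, measureReal_def, Measure.pi_pi_finset, ENNReal.toReal_prod]
  refine Finset.prod_congr rfl fun e _ => ?_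
  exact bernoulliMeasure_real_apply_of_mem_of_notMem _ (MeasurableSet.singleton _) (by simp)
    (by simp)

theorem real_all_open_right_le {n : ℕ} {pLeft pRight : unitInterval}
    (A : Finset (Fin n × Fin n)) :
    (configMeasure n pLeft pRight).real {ω | ∀ e ∈ A, e.1 < e.2 ∧ ω e = true} ≤
      (pRight : ℝ) ^ A.card := by
  by_cases h : ∀ e ∈ A, e.1 < e.2
  · calc _ ≤ (configMeasure n pLeft pRight).real {ω | ∀ e ∈ A, ω e = true} :=
          measureReal_mono fun ω hω e he => (hω e he).2
      _ = ∏ e ∈ A, (pRight : ℝ) := by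
          rw [configMeasure_real_forall_open]
          exact Finset.prod_congr rfl fun e he => by rw [edgeDensity, if_pos (h e he)]
      _ ≤ _ := by rw [Finset.prod_const]
  · have : {ω : Fin n × Fin n → Bool | ∀ e ∈ A, e.1 < e.2 ∧ ω e = true} = ∅ :=
      Set.eq_empty_of_forall_notMem fun ω hω => h fun e he => (hω e he).1
    rw [this, measureReal_empty]
    exact pow_nonneg pRight.2.1 _

theorem real_all_open_left_le {n : ℕ} {pLeft pRight : unitInterval}
    (A : Finset (Fin n × Fin n)) :
    (configMeasure n pLeft pRight).real {ω | ∀ e ∈ A, e.2 < e.1 ∧ ω e = true} ≤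
      (pLeft : ℝ) ^ A.card := by
  by_cases h : ∀ e ∈ A, e.2 < e.1
  · calc _ ≤ (configMeasure n pLeft pRight).real {ω | ∀ e ∈ A, ω e = true} :=
          measureReal_mono fun ω hω e he => (hω e he).2
      _ = ∏ e ∈ A, (pLeft : ℝ) := by
          rw [configMeasure_real_forall_open]
          exact Finset.prod_congr rfl fun e he => by rw [edgeDensity, if_neg (h e he).not_gt]
      _ ≤ _ := by rw [Finset.prod_const]
  · have : {ω : Fin n × Fin n → Bool | ∀ e ∈ A, e.2 < e.1 ∧ ω e = true} = ∅ :=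
      Set.eq_empty_of_forall_notMem fun ω hω => h fun e he => (hω e he).1
    rw [this, measureReal_empty]
    exact pow_nonneg pLeft.2.1 _

/-- The configurations with an open derivation tree at `a` of word length at most `K`, using `N`
distinct rightward edges. -/
def treeEvent (n : ℕ) (a : ℤ) (K N : ℕ) : Set (Fin n × Fin n → Bool) :=
  {ω | ∃ (T : SplitTree) (A : Finset (Fin n × Fin n)),
    (∀ f ∈ A, f.1 < f.2 ∧ ω f = true) ∧ A.image intEdge = T.edges a ∧
    T.toWord.length ≤ K ∧ A.card = N}

/-- The start `a` and the code determine the tree, hence its edge set `A`; so each of the `4 ^ K`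
codes contributes at most `pRight ^ N`. -/
theorem real_treeEvent_le {n : ℕ} {pLeft pRight : unitInterval} (a : ℤ) (K N : ℕ) :
    (configMeasure n pLeft pRight).real (treeEvent n a K N) ≤ 4 ^ K * (pRight : ℝ) ^ N := by
  classical
  let F : (Fin K → Fin 4) → Set (Fin n × Fin n → Bool) := fun c =>
    {ω | ∃ (T : SplitTree) (A : Finset (Fin n × Fin n)),
      (∀ f ∈ A, f.1 < f.2 ∧ ω f = true) ∧ A.image intEdge = T.edges a ∧
      T.toWord.length ≤ K ∧ A.card = N ∧ T.code K = c}
  have hF : ∀ c, (configMeasure n pLeft pRight).real (F c) ≤ (pRight : ℝ) ^ N := by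
    intro c
    rcases (F c).eq_empty_or_nonempty with h | ⟨ω₀, T₀, A₀, -, hi₀, hl₀, hc₀, hT₀⟩
    · rw [h, measureReal_empty]
      exact pow_nonneg pRight.2.1 _
    · rw [← hc₀]
      refine le_trans (measureReal_mono ?_) (real_all_open_right_le (pLeft := pLeft) A₀)
      rintro ω ⟨T, A, ho, hi, hl, hc, hT⟩
      obtain rfl := SplitTree.code_inj hl hl₀ (hT.trans hT₀.symm)
      obtain rfl := Finset.image_injective intEdge_injective (hi.trans hi₀.symm)
      exact ho
  calc (configMeasure n pLeft pRight).real (treeEvent n a K N)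
      ≤ (configMeasure n pLeft pRight).real (⋃ c ∈ Finset.univ, F c) := by
        refine measureReal_mono ?_ (measure_ne_top _ _)
        rintro ω ⟨T, A, ho, hi, hl, hc⟩
        exact Set.mem_biUnion (Finset.mem_univ (T.code K)) ⟨T, A, ho, hi, hl, hc, rfl⟩
    _ ≤ ∑ c, (configMeasure n pLeft pRight).real (F c) := measureReal_biUnion_finset_le _ _
    _ ≤ ∑ _c : Fin K → Fin 4, (pRight : ℝ) ^ N := Finset.sum_le_sum fun c _ => hF c
    _ = 4 ^ K * (pRight : ℝ) ^ N := by simp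

/-- The edges with both endpoints within distance `R` of `u`. -/
def nearEdges {n : ℕ} (u : Fin n) (R : ℕ) : Finset (Fin n × Fin n) :=
  Finset.univ.filter fun f => ((f.1 : ℕ) ≤ u + R ∧ (u : ℕ) ≤ f.1 + R) ∧
    (f.2 : ℕ) ≤ u + R ∧ (u : ℕ) ≤ f.2 + R

theorem card_nearEdges_le {n : ℕ} (u : Fin n) (R : ℕ) :
    (nearEdges u R).card ≤ (2 * R + 1) ^ 2 := by
  have hsub : (nearEdges u R).image intEdge ⊆
      Finset.Icc ((u : ℕ) - R : ℤ) ((u : ℕ) + R) ×ˢ Finset.Icc ((u : ℕ) - R : ℤ) ((u : ℕ) + R) := by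
    intro x hx
    obtain ⟨f, hf, rfl⟩ := Finset.mem_image.1 hx
    simp only [nearEdges, Finset.mem_filter] at hf
    simp only [intEdge, Finset.mem_product, Finset.mem_Icc]
    omega
  have := Finset.card_le_card hsub
  rw [Finset.card_image_of_injective _ intEdge_injective, Finset.card_product, Int.card_Icc,
    ← sq] at this
  convert this using 3
  omega

/-- The configurations with `k` open leftward edges close to one vertex. -/
def leftCluster (n R k : ℕ) : Set (Fin n × Fin n → Bool) :=
  {ω | ∃ (u : Fin n) (A : Finset (Fin n × Fin n)), A ⊆ nearEdges u R ∧ A.card = k ∧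
    ∀ f ∈ A, f.2 < f.1 ∧ ω f = true}

theorem real_leftCluster_le {n : ℕ} {pLeft pRight : unitInterval} (R k : ℕ) :
    (configMeasure n pLeft pRight).real (leftCluster n R k) ≤
      n * 2 ^ ((2 * R + 1) ^ 2) * (pLeft : ℝ) ^ k := by
  classical
  calc (configMeasure n pLeft pRight).real (leftCluster n R k)
      ≤ (configMeasure n pLeft pRight).real (⋃ u ∈ (Finset.univ : Finset (Fin n)),
          ⋃ A ∈ (nearEdges u R).powersetCard k, {ω | ∀ f ∈ A, f.2 < f.1 ∧ ω f = true}) := by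
        refine measureReal_mono ?_ (measure_ne_top _ _)
        rintro ω ⟨u, A, hA, hk, h⟩
        exact Set.mem_biUnion (Finset.mem_univ u)
          (Set.mem_biUnion (Finset.mem_coe.2 (Finset.mem_powersetCard.2 ⟨hA, hk⟩)) h)
    _ ≤ ∑ _u : Fin n, 2 ^ ((2 * R + 1) ^ 2) * (pLeft : ℝ) ^ k := by
        refine (measureReal_biUnion_finset_le _ _).trans (Finset.sum_le_sum fun u _ => ?_)
        refine (measureReal_biUnion_finset_le _ _).trans ?_
        calc _ ≤ ∑ _A ∈ (nearEdges u R).powersetCard k, (pLeft : ℝ) ^ k := by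
              refine Finset.sum_le_sum fun A hA => ?_
              rw [← (Finset.mem_powersetCard.1 hA).2]
              exact real_all_open_left_le A
          _ ≤ _ := by
              rw [Finset.sum_const, nsmul_eq_mul]
              refine mul_le_mul_of_nonneg_right ?_ (pow_nonneg pLeft.2.1 _)
              rw [Finset.card_powersetCard]
              calc (((nearEdges u R).card.choose k : ℕ) : ℝ)
                  ≤ ((2 ^ (nearEdges u R).card : ℕ) : ℝ) := by
                    exact_mod_cast Nat.choose_le_two_pow _ _
                _ ≤ _ := by
                    push_cast
                    exact pow_le_pow_right₀ (by norm_num) (card_nearEdges_le u R)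
    _ = _ := by simp [mul_assoc]

/-! ### Assembling the estimates -/

/-- A configuration with an edge longer than `log n` in `E_∞` has a cluster of open leftward edges
or a derivation tree with many rightward edges. -/
theorem long_edge_subset {n m R : ℕ} (hR : (m + 1) * (2 * 2 ^ m) ≤ R)
    (hn : (2 ^ m : ℝ) < Real.log n) :
    {ω | ∃ e ∈ linearFinal n ω, Real.log (n : ℝ) < (edgeLength e : ℝ)} ⊆
      leftCluster n R (m + 1) ∪ ⋃ i ∈ (Finset.univ : Finset (Fin n)),
        ⋃ N ∈ (Finset.range (n ^ 2 + 1)).filter (fun N : ℕ => Real.log n < N + 1),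
          treeEvent n (i : ℕ) ((2 * 2 ^ m + 3) * (N + 1)) N := by
  rintro ω ⟨e, he, hlong⟩
  by_cases hω : ω ∈ leftCluster n R (m + 1)
  · exact Or.inl hω
  right
  have hshort := left_short_of_no_cluster
    (Eopen := openEdges (orientedEdges (SimpleGraph.pathGraph n)) ω) hR (by
      intro u A hA hall
      refine hω ⟨u, A, fun f hf => ?_, hA, fun f hf => ⟨(hall f hf).2.1, (hall f hf).1.2.2⟩⟩
      obtain ⟨-, -, h1, h2, h3, h4⟩ := hall f hf
      simp only [nearEdges, Finset.mem_filter, Finset.mem_univ, true_and]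
      exact ⟨⟨h1, h2⟩, h3, h4⟩)
  obtain ⟨t, ht⟩ := Set.mem_iUnion.1 he
  have hlen := edgeLength_le e
  have hle := hshort t e ht
  -- Longer than any occupied leftward edge, so `e` points right.
  have hgt : 2 ^ m < edgeLength e := by exact_mod_cast hn.trans hlong
  have h1 := Nat.one_le_two_pow (n := m)
  obtain ⟨T, A, ho, hi, hl, hN⟩ := exists_splitTree_of_long hshort ht (by omega)
  have hA : A.card ≤ n ^ 2 := by
    have := Finset.card_le_univ A
    simpa [sq] using this
  refine Set.mem_biUnion (Finset.mem_coe.2 (Finset.mem_univ e.1))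
    (Set.mem_biUnion (x := A.card) ?_ ⟨T, A, fun f hf => ⟨(ho f hf).1, (ho f hf).2.2.2⟩, hi, hl, rfl⟩)
  simp only [Finset.coe_filter, Finset.mem_range, Set.mem_ofPred_eq]
  refine ⟨by omega, hlong.trans_le ?_⟩
  exact_mod_cast (by omega : edgeLength e ≤ A.card + 1)

theorem real_long_edge_le {n m R : ℕ} {pLeft pRight : unitInterval} {c : ℝ}
    (hR : (m + 1) * (2 * 2 ^ m) ≤ R) (hn : (2 ^ m : ℝ) < Real.log n) (hc : 2 ≤ c * (m + 1))
    (hl : (pLeft : ℝ) ≤ (n : ℝ) ^ (-c))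
    (hr : 4 ^ (2 * 2 ^ m + 3) * (pRight : ℝ) ≤ Real.exp (-6)) :
    (configMeasure n pLeft pRight).real
      {ω | ∃ e ∈ linearFinal n ω, Real.log (n : ℝ) < (edgeLength e : ℝ)} ≤
      (2 ^ ((2 * R + 1) ^ 2) + 2 * 4 ^ (2 * 2 ^ m + 3) * Real.exp 6) * (n : ℝ)⁻¹ := by
  have hn0 : n ≠ 0 := by
    rintro rfl
    have : (0 : ℝ) < 2 ^ m := by positivity
    simp at hn
    linarith
  have hn1 : (1 : ℝ) ≤ n := by exact_mod_cast Nat.one_le_iff_ne_zero.2 hn0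
  have hnpos : (0 : ℝ) < n := by linarith
  have hleft : (configMeasure n pLeft pRight).real (leftCluster n R (m + 1)) ≤
      2 ^ ((2 * R + 1) ^ 2) * (n : ℝ)⁻¹ := by
    refine (real_leftCluster_le R (m + 1)).trans ?_
    -- The exponent 2 beats the `n` choices of the cluster's centre.
    have : (pLeft : ℝ) ^ (m + 1) ≤ (n : ℝ)⁻¹ ^ 2 := by
      calc (pLeft : ℝ) ^ (m + 1) ≤ ((n : ℝ) ^ (-c)) ^ (m + 1) :=
            pow_le_pow_left₀ pLeft.2.1 hl _
        _ = (n : ℝ) ^ (-(c * (m + 1))) := by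
            rw [← Real.rpow_natCast, ← Real.rpow_mul hnpos.le]; push_cast; ring_nf
        _ ≤ (n : ℝ) ^ (-2 : ℝ) := Real.rpow_le_rpow_of_exponent_le hn1 (by linarith)
        _ = _ := by rw [Real.rpow_neg hnpos.le, inv_pow]; norm_cast
    calc _ ≤ n * 2 ^ ((2 * R + 1) ^ 2) * (n : ℝ)⁻¹ ^ 2 :=
          mul_le_mul_of_nonneg_left this (by positivity)
      _ = _ := by field_simp
  have hright : ∀ (i : Fin n), ∀ N ∈ (Finset.range (n ^ 2 + 1)).filter
      (fun N : ℕ => Real.log n < N + 1),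
      (configMeasure n pLeft pRight).real
        (treeEvent n (i : ℕ) ((2 * 2 ^ m + 3) * (N + 1)) N) ≤
        4 ^ (2 * 2 ^ m + 3) * Real.exp 6 * (n : ℝ)⁻¹ ^ 6 := by
    intro i N hN
    have hN := (Finset.mem_filter.1 hN).2
    refine (real_treeEvent_le _ _ _).trans ?_
    have h6 : (n : ℝ)⁻¹ ^ 6 = Real.exp (-6 * Real.log n) := by
      rw [← Real.exp_log hnpos, ← Real.exp_neg, ← Real.exp_nat_mul, Real.log_exp]; norm_num
    calc (4 : ℝ) ^ ((2 * 2 ^ m + 3) * (N + 1)) * (pRight : ℝ) ^ N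
        = 4 ^ (2 * 2 ^ m + 3) * (4 ^ (2 * 2 ^ m + 3) * (pRight : ℝ)) ^ N := by
          rw [pow_mul, pow_succ, mul_pow]; ring
      _ ≤ 4 ^ (2 * 2 ^ m + 3) * Real.exp (-6) ^ N := by
          refine mul_le_mul_of_nonneg_left (pow_le_pow_left₀ ?_ hr _) (by positivity)
          exact mul_nonneg (by positivity) pRight.2.1
      _ ≤ 4 ^ (2 * 2 ^ m + 3) * (Real.exp 6 * (n : ℝ)⁻¹ ^ 6) := by
          refine mul_le_mul_of_nonneg_left ?_ (by positivity)
          rw [h6, ← Real.exp_nat_mul, ← Real.exp_add]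
          -- `N > log n - 1` turns `exp (-6 * N)` into at most `exp 6 * n⁻¹ ^ 6`, enough to absorb
          -- the `n * (n ^ 2 + 1)` choices of start and `N`.
          exact Real.exp_le_exp.2 (by linarith)
      _ = _ := by ring
  calc _ ≤ _ := measureReal_mono (long_edge_subset hR hn)
    _ ≤ _ := measureReal_union_le _ _
    _ ≤ 2 ^ ((2 * R + 1) ^ 2) * (n : ℝ)⁻¹ + ∑ _i : Fin n,
        ∑ _N ∈ Finset.range (n ^ 2 + 1), 4 ^ (2 * 2 ^ m + 3) * Real.exp 6 * (n : ℝ)⁻¹ ^ 6 := by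
      refine add_le_add hleft ((measureReal_biUnion_finset_le _ _).trans
        (Finset.sum_le_sum fun i _ => ?_))
      refine (measureReal_biUnion_finset_le _ _).trans
        ((Finset.sum_le_sum (hright i)).trans ?_)
      exact Finset.sum_le_sum_of_subset_of_nonneg (Finset.filter_subset _ _)
        fun _ _ _ => by positivity
    _ = 2 ^ ((2 * R + 1) ^ 2) * (n : ℝ)⁻¹ +
        4 ^ (2 * 2 ^ m + 3) * Real.exp 6 * ((n * (n ^ 2 + 1)) * (n : ℝ)⁻¹ ^ 6) := by
      simp; ring
    _ ≤ 2 ^ ((2 * R + 1) ^ 2) * (n : ℝ)⁻¹ +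
        4 ^ (2 * 2 ^ m + 3) * Real.exp 6 * (2 * (n : ℝ)⁻¹) := by
      refine add_le_add le_rfl (mul_le_mul_of_nonneg_left ?_ (by positivity))
      have h2 : (n : ℝ) * (n ^ 2 + 1) ≤ 2 * n ^ 5 := by
        have h3 : (n : ℝ) ^ 3 ≤ n ^ 5 := pow_le_pow_right₀ hn1 (by norm_num)
        have h4 : (n : ℝ) ^ 1 ≤ n ^ 5 := pow_le_pow_right₀ hn1 (by norm_num)
        linarith
      calc (n : ℝ) * (n ^ 2 + 1) * (n : ℝ)⁻¹ ^ 6 ≤ 2 * n ^ 5 * (n : ℝ)⁻¹ ^ 6 :=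
            mul_le_mul_of_nonneg_right h2 (by positivity)
        _ = _ := by field_simp
    _ = _ := by ring

end TransitiveClosure

theorem theorem3 (c₁ : ℝ) (hc₁ : 0 < c₁) :
    ∃ c₂ : ℝ, 0 < c₂ ∧
      ∀ pLeft pRight : ℕ → unitInterval,
        (∀ᶠ n : ℕ in atTop, (pLeft n : ℝ) < (n : ℝ) ^ (-c₁) ∧ (pRight n : ℝ) < c₂) →
        Tendsto
          (fun n : ℕ => TransitiveClosure.configMeasure n (pLeft n) (pRight n)
            {ω | ¬ ∃ e ∈ TransitiveClosure.linearFinal n ω,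
              Real.log (n : ℝ) < (TransitiveClosure.edgeLength e : ℝ)})
          atTop (𝓝 1) := by
  obtain ⟨m, hm⟩ := exists_nat_ge (2 / c₁)
  -- Chosen so that the word count per node, `4 ^ (2 * M + 3)`, times `pRight` is at most `exp
  -- (-6)`.
  refine ⟨Real.exp (-6) / 4 ^ (2 * 2 ^ m + 3), by positivity, fun pLeft pRight hp => ?_⟩
  set μ := fun n : ℕ => TransitiveClosure.configMeasure n (pLeft n) (pRight n)
  set bad : (n : ℕ) → Set (Fin n × Fin n → Bool) := fun n =>
    {ω | ∃ e ∈ TransitiveClosure.linearFinal n ω,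
      Real.log (n : ℝ) < (TransitiveClosure.edgeLength e : ℝ)}
  obtain ⟨C, hC⟩ : ∃ C : ℝ, ∀ᶠ n : ℕ in atTop, (μ n).real (bad n) ≤ C * (n : ℝ)⁻¹ := by
    let R := (m + 1) * (2 * 2 ^ m)
    refine ⟨2 ^ ((2 * R + 1) ^ 2) + 2 * 4 ^ (2 * 2 ^ m + 3) * Real.exp 6, ?_⟩
    filter_upwards [hp,
      (Real.tendsto_log_atTop.comp tendsto_natCast_atTop_atTop).eventually_gt_atTop
      ((2 : ℝ) ^ m)] with n hn hlog
    refine TransitiveClosure.real_long_edge_le (m := m) (c := c₁) le_rfl hlog ?_ hn.1.le ?_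
    · rw [div_le_iff₀ hc₁] at hm
      linarith
    · have := hn.2.le
      rw [le_div_iff₀ (by positivity)] at this
      linarith
  have hgood : Tendsto (fun n => (μ n).real (bad n)ᶜ) atTop (𝓝 1) := by
    have hlim : Tendsto (fun n : ℕ => 1 - C * (n : ℝ)⁻¹) atTop (𝓝 1) := by
      simpa using (tendsto_inv_atTop_nhds_zero_nat (𝕜 := ℝ)).const_mul C |>.const_sub 1
    refine tendsto_of_tendsto_of_tendsto_of_le_of_le' hlim tendsto_const_nhds ?_
      (Eventually.of_forall fun n => measureReal_le_one)
    filter_upwards [hC] with n hn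
    have h1 := measureReal_union_le (μ := μ n) (bad n) (bad n)ᶜ
    rw [Set.union_compl_self, probReal_univ] at h1
    linarith
  have := ENNReal.tendsto_ofReal hgood
  rw [ENNReal.ofReal_one] at this
  refine this.congr fun n => ?_
  rw [ofReal_measureReal]
  rfl
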